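/- All topological spaces are assumed completely regular and Hausdorff. For a space $X$ let $\beta X$ be its Stone–Čech compactification and $C(X)$ the ring of continuous functions $X\to\mathbb R$. A space is *realcompact* if it admits a closed embedding into a power $\mathbb R^{\kappa}$ of the real line. A point $x\in\beta X$ is *real* if every continuous map $X\to\mathbb R$ extends to a continuous map $X\cup\{x\}\to\mathbb R$ (where $X\cup\{x\}\subseteq\beta X$ has the subspace topology); the *realcompactification* $\upsilon X$ is the subspace of $\beta X$ consisting of the real points, and it contains $X$. Let $\mathsf P$ be a class of spaces closed under homeomorphism (regarded as a full subcategory of the category of completely regular Hausdorff spaces and continuous maps). A *functorial $\mathsf P$-ification* of $X$ is a continuous map $i: X\to N$ with $N\in\mathsf P$ such that for every $Y\in\mathsf P$ and every continuous map $f:X\to Y$ there is a unique continuous map $g:N\to Y$ with $g\circ i=f$. **Theorem.** Suppose that $\mathsf P$ contains every compact Hausdorff space and the real line $\mathbb R$, and that every space in $\mathsf P$ is realcompact. Then for every completely regular Hausdorff space $X$ the following are equivalent: 1. $X$ admits a functorial $\mathsf P$-ification; 2. $\upsilon X\in\mathsf P$; 3. there exists $Y\in\mathsf P$ such that $C(X)$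 and $C(Y)$ are isomorphic as rings. Moreover, if these conditions hold, then the inclusion $X\hookrightarrow\upsilon X$ is a functorial $\mathsf P$-ification of $X$; every functorial $\mathsf P$-ification $i:X\to N$ is of the form $i = e\circ(X\hookrightarrow\upsilon X)$ for some homeomorphism $e:\upsilon X\to N$; and for every $Y\in\mathsf P$ such that $C(X)\cong C(Y)$ as rings there is a homeomorphism $e:\upsilon X\to Y$, for which the composite $X\hookrightarrow\upsilon X\to Y$ is a functorial $\mathsf P$-ification of $X$. -/

import Mathlib

open CategoryTheory Topology

universe u

/-- A space is realcompact if it admits a closed embedding into some power of the real line. -/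
def IsRealcompact : ObjectProperty TopCat.{u} := fun X =>
  ∃ (ι : Type u) (f : X → (ι → ℝ)), IsClosedEmbedding f

/-- The compact Hausdorff spaces. -/
def IsCompactHausdorff : ObjectProperty TopCat.{u} := fun X =>
  CompactSpace X ∧ T2Space X

/-- A continuous map `i : X ⟶ N` is a `P`-ification of `X` if `N` belongs to `P` and every
continuous map from `X` to a space in `P` factors uniquely through `i`. -/
def IsPification (P : ObjectProperty TopCat.{u}) {X N : TopCat.{u}} (i : X ⟶ N) : Prop :=
  P N ∧ ∀ Y : TopCat.{u}, P Y → ∀ f : X ⟶ Y, ∃! g : N ⟶ Y, i ≫ g = f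

/-- `X` admits a functorial `P`-ification. -/
def AdmitsPification (P : ObjectProperty TopCat.{u}) (X : TopCat.{u}) : Prop :=
  ∃ (N : TopCat.{u}) (i : X ⟶ N), IsPification P i

/-- A point `x` of the Stone–Čech compactification of `X` is real if every continuous
`f : X → ℝ` extends to a continuous real-valued function on the subspace `X ∪ {x}`. -/
def IsRealPoint (X : TopCat.{u}) (x : StoneCech X) : Prop :=
  ∀ f : C(X, ℝ), ∃ g : StoneCech X → ℝ,
    ContinuousOn g (Set.range (stoneCechUnit : X → StoneCech X) ∪ {x}) ∧
      ∀ a : X, g (stoneCechUnit a) = f a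

/-- The realcompactification of `X`: the subspace of real points of the Stone–Čech
compactification. -/
def realcompactification (X : TopCat.{u}) : TopCat.{u} :=
  TopCat.of {x : StoneCech X // IsRealPoint X x}

/-- Every point of a completely regular Hausdorff space is a real point. -/
theorem isRealPoint_stoneCechUnit (X : TopCat.{u}) [T35Space X] (a : X) :
    IsRealPoint X (stoneCechUnit a) := by
  intro f
  have he : IsEmbedding (stoneCechUnit : X → StoneCech X) :=
    isDenseEmbedding_stoneCechUnit.isEmbedding
  refine ⟨Function.extend stoneCechUnit f 0, ?_, fun b => he.injective.extend_apply _ _ _⟩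
  rw [Set.union_eq_self_of_subset_right (by simp)]
  rintro _ ⟨b, rfl⟩
  rw [ContinuousWithinAt, he.injective.extend_apply, ← Set.image_univ, ← he.map_nhdsWithin_eq,
    nhdsWithin_univ, Filter.tendsto_map'_iff, Function.extend_comp he.injective]
  exact f.continuous.tendsto b

/-- The canonical map from `X` to its realcompactification. -/
def toRealcompactification (X : TopCat.{u}) [T35Space X] : X ⟶ realcompactification X :=
  TopCat.ofHom ⟨fun a => ⟨stoneCechUnit a, isRealPoint_stoneCechUnit X a⟩,
    continuous_stoneCechUnit.subtype_mk _⟩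

/-! Everything reduces to dense `C`-embeddings `X → N` with `N` realcompact. Such a map has the
universal property for realcompact targets: extend coordinatewise into a power of `ℝ`, and
closedness of the target keeps the values inside. Conversely, since `ℝ` is in `P`, a `P`-ification
is a dense `C`-embedding, and `exists_iso` identifies its target with `υX`. A ring isomorphism `C(X)
≅ C(Y)` with `Y` realcompact also yields one, because characters of `C(Y)` are point evaluations
(`exists_eval`). -/

/-- A map with dense range along which every continuous real-valued function extends. -/
structure IsDenseCEmbedding {X N : Type*} [TopologicalSpace X] [TopologicalSpace N]
    (i : X → N) : Prop where
  denseRange : DenseRange i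
  exists_extension : ∀ f : C(X, ℝ), ∃ F : C(N, ℝ), ∀ a, F (i a) = f a

theorem IsRealcompact.t35Space {Y : TopCat.{u}} (hY : IsRealcompact Y) : T35Space Y := by
  obtain ⟨ι, e, he⟩ := hY
  exact he.isEmbedding.t35Space

theorem isRealcompact_of_compactSpace (K : TopCat.{u}) [CompactSpace K] [T2Space K] :
    IsRealcompact K := by
  refine ⟨C(K, ℝ), fun x f => f x, Continuous.isClosedEmbedding (by fun_prop) ?_⟩
  intro x y hxy
  by_contra hne
  obtain ⟨f, hf, hfxy⟩ := separatesPoints_continuous_of_t35Space hne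
  exact hfxy (congrFun hxy ⟨f, hf⟩)

/-- Continuous maps into realcompact spaces extend along dense `C`-embeddings. -/
theorem IsDenseCEmbedding.existsUnique_lift {X N Y : TopCat.{u}} {i : X ⟶ N}
    (hi : IsDenseCEmbedding i) (hY : IsRealcompact Y) (f : X ⟶ Y) :
    ∃! g : N ⟶ Y, i ≫ g = f := by
  have := hY.t35Space
  obtain ⟨ι, e, he⟩ := hY
  choose F hF using fun k : ι => hi.exists_extension
    ⟨fun x => e (f x) k, (continuous_apply k).comp (he.continuous.comp f.hom.continuous)⟩
  let G : N → ι → ℝ := fun y k => F k y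
  have hGc : Continuous G := continuous_pi fun k => (F k).continuous
  have hG : ∀ x, G (i x) = e (f x) := fun x => funext fun k => hF k x
  have hmem : ∀ y, G y ∈ Set.range e := by
    intro y
    refine hi.denseRange.induction_on (p := fun y => G y ∈ Set.range e) y
      (he.isClosed_range.preimage hGc) ?_
    intro x
    exact ⟨f x, (hG x).symm⟩
  choose g hg using hmem
  have hgc : Continuous g := by
    rw [he.isEmbedding.continuous_iff]
    exact hGc.congr fun y => (hg y).symm
  refine ⟨TopCat.ofHom ⟨g, hgc⟩, ?_, ?_⟩
  · ext x
    exact he.injective ((hg (i x)).trans (hG x))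
  · intro g' hg'
    ext y
    refine congrFun (hi.denseRange.equalizer g'.hom.continuous hgc (funext fun x => ?_)) y
    refine (ConcreteCategory.congr_hom hg' x).trans ?_
    exact he.injective ((hG x).symm.trans (hg (i x)).symm)

theorem IsDenseCEmbedding.isPification {P : ObjectProperty TopCat.{u}}
    (hRCpt : P ≤ IsRealcompact.{u}) {X N : TopCat.{u}} {i : X ⟶ N}
    (hi : IsDenseCEmbedding i) (hN : P N) : IsPification P i :=
  ⟨hN, fun Y hY f => hi.existsUnique_lift (hRCpt Y hY) f⟩

/-- Extension is existence of factorizations through `ℝ`; density is their uniqueness, since a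
function separating a point from the closure of the image would agree with a constant on `X`. -/
theorem IsPification.isDenseCEmbedding {P : ObjectProperty TopCat.{u}}
    (hReal : P (TopCat.of (ULift.{u} ℝ))) (hRCpt : P ≤ IsRealcompact.{u})
    {X N : TopCat.{u}} {i : X ⟶ N} (hi : IsPification P i) : IsDenseCEmbedding i := by
  have := (hRCpt N hi.1).t35Space
  constructor
  · intro p
    by_contra hp
    obtain ⟨f, hf, hfp, hfc⟩ := CompletelyRegularSpace.completely_regular p _ isClosed_closure hp
    let F : N ⟶ TopCat.of (ULift.{u} ℝ) := TopCat.ofHom ⟨fun y => ⟨f y⟩, by fun_prop⟩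
    let G : N ⟶ TopCat.of (ULift.{u} ℝ) := TopCat.ofHom ⟨fun _ => ⟨1⟩, by fun_prop⟩
    have hFG : F = G := by
      refine (hi.2 _ hReal (i ≫ G)).unique ?_ rfl
      ext x
      have h1 : f (i x) = 1 := hfc (subset_closure ⟨x, rfl⟩)
      change (f (i x) : ℝ) = 1
      simp [h1]
    have h := congrArg ULift.down (ConcreteCategory.congr_hom hFG p)
    change (f p : ℝ) = 1 at h
    simp [hfp] at h
  · intro f
    obtain ⟨g, hg, -⟩ := hi.2 _ hReal (TopCat.ofHom ⟨fun x => ⟨f x⟩, by fun_prop⟩)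
    refine ⟨⟨fun y => (g y).down, continuous_uliftDown.comp g.hom.continuous⟩, fun a => ?_⟩
    exact congrArg ULift.down (ConcreteCategory.congr_hom hg a)

/-! ### Real points and the realcompactification -/

/-- If `f` has a limit at every point of `S`, then it extends continuously to `S`. -/
theorem exists_extension_of_tendsto {X B : Type*} [TopologicalSpace X] [TopologicalSpace B]
    {j : X → B} (hj : IsDenseInducing j) {S : Set B} (hS : ∀ a, j a ∈ S) (f : C(X, ℝ))
    (hf : ∀ b ∈ S, ∃ c, Filter.Tendsto f (Filter.comap j (𝓝 b)) (𝓝 c)) :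
    ∃ F : C(S, ℝ), ∀ a, F ⟨j a, hS a⟩ = f a := by
  have hd : IsDenseInducing (fun a => (⟨j a, hS a⟩ : S)) := by
    refine ⟨hj.isInducing.codRestrict hS, fun s => ?_⟩
    rw [closure_subtype, ← Set.range_comp]
    exact hj.dense s
  have hlim : ∀ b : S, ∃ c,
      Filter.Tendsto f (Filter.comap (fun a => (⟨j a, hS a⟩ : S)) (𝓝 b)) (𝓝 c) := by
    intro b
    rw [nhds_subtype, Filter.comap_comap]
    exact hf b b.2
  exact ⟨⟨hd.extend f, hd.continuous_extend hlim⟩, fun a => hd.extend_eq f.continuous a⟩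

/-- Extensions to one point at a time become limits, which glue to a single extension over all real
points. -/
theorem isRealPoint_iff_tendsto (X : TopCat.{u}) [T35Space X] (x : StoneCech X) :
    IsRealPoint X x ↔ ∀ f : C(X, ℝ), ∃ c,
      Filter.Tendsto f (Filter.comap stoneCechUnit (𝓝 x)) (𝓝 c) := by
  constructor
  · intro hx f
    obtain ⟨g, hg, hgf⟩ := hx f
    refine ⟨g x, ?_⟩
    have h1 : Filter.Tendsto (stoneCechUnit : X → StoneCech X)
        (Filter.comap stoneCechUnit (𝓝 x)) (𝓝[Set.range stoneCechUnit ∪ {x}] x) :=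
      tendsto_nhdsWithin_iff.2 ⟨Filter.tendsto_comap, Filter.Eventually.of_forall fun a =>
        Or.inl ⟨a, rfl⟩⟩
    exact ((hg x (Or.inr rfl)).tendsto.comp h1).congr hgf
  · intro hx f
    obtain ⟨F, hF⟩ := exists_extension_of_tendsto (j := (stoneCechUnit : X → StoneCech X))
      isDenseInducing_stoneCechUnit (S := Set.range stoneCechUnit ∪ {x})
      (fun a => Or.inl ⟨a, rfl⟩) f (by
        rintro b (⟨a, rfl⟩ | rfl)
        · rw [← isDenseInducing_stoneCechUnit.nhds_eq_comap]
          exact ⟨f a, f.continuous.tendsto a⟩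
        · exact hx f)
    refine ⟨Function.extend Subtype.val F 0, ?_, fun a => ?_⟩
    · rw [continuousOn_iff_continuous_domRestrict]
      refine F.continuous.congr fun b => ?_
      exact (Subtype.val_injective.extend_apply F 0 b).symm
    · rw [← hF a]
      exact Subtype.val_injective.extend_apply F 0 ⟨stoneCechUnit a, Or.inl ⟨a, rfl⟩⟩

theorem isDenseCEmbedding_toRealcompactification (X : TopCat.{u}) [T35Space X] :
    IsDenseCEmbedding (toRealcompactification X) := by
  constructor
  · change DenseRange fun a : X =>
      (⟨stoneCechUnit a, isRealPoint_stoneCechUnit X a⟩ : {x // IsRealPoint X x})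
    intro s
    rw [closure_subtype, ← Set.range_comp]
    exact denseRange_stoneCechUnit s.1
  · intro f
    exact exists_extension_of_tendsto (j := (stoneCechUnit : X → StoneCech X))
      isDenseInducing_stoneCechUnit (S := {x | IsRealPoint X x})
      (isRealPoint_stoneCechUnit X) f
      fun b hb => (isRealPoint_iff_tendsto X b).1 hb f

/-- A map to the Stone–Čech compactification from a space in which `X` is densely `C`-embedded
takes values in the real points. -/
theorem IsDenseCEmbedding.isRealPoint {X N : TopCat.{u}} [T35Space X] {i : X ⟶ N}
    (hi : IsDenseCEmbedding i) {h : N → StoneCech X} (hc : Continuous h)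
    (hh : ∀ a, h (i a) = stoneCechUnit a) (y : N) : IsRealPoint X (h y) := by
  rw [isRealPoint_iff_tendsto]
  intro f
  obtain ⟨F, hF⟩ := hi.exists_extension f
  refine ⟨F y, ?_⟩
  -- The truncation of `f` to `[-M, M]` extends to the Stone–Čech compactification. As `F y` is
  -- interior to the interval, truncation changes nothing near `h y`, so `f` itself tends to `F y`
  -- there.
  set M : ℝ := |F y| + 1 with hM
  have hM0 : -M ≤ M := by have := abs_nonneg (F y); linarith
  have hy : F y ∈ Set.Ioo (-M) M := abs_lt.1 (by linarith)
  have hTc : Continuous fun a : X => Set.projIcc (-M) M hM0 (f a) :=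
    continuous_projIcc.comp f.continuous
  let G : StoneCech X → ℝ := fun b => (stoneCechExtend hTc b : Set.Icc (-M) M)
  have hGc : Continuous G := continuous_subtype_val.comp (continuous_stoneCechExtend hTc)
  have hGa : ∀ a, G (stoneCechUnit a) = Set.projIcc (-M) M hM0 (f a) := fun a =>
    congrArg Subtype.val (stoneCechExtend_stoneCechUnit hTc a)
  have hGh : G ∘ h = fun y => (Set.projIcc (-M) M hM0 (F y) : ℝ) := by
    refine hi.denseRange.equalizer (hGc.comp hc)
      (continuous_subtype_val.comp (continuous_projIcc.comp F.continuous)) (funext fun a => ?_)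
    simp only [Function.comp_apply, hh, hGa, hF]
  have hGy : G (h y) = F y := by
    have := congrFun hGh y
    rwa [Set.projIcc_of_mem hM0 (Set.Ioo_subset_Icc_self hy)] at this
  have htend : Filter.Tendsto (fun a => G (stoneCechUnit a))
      (Filter.comap stoneCechUnit (𝓝 (h y))) (𝓝 (F y)) := by
    rw [← hGy]
    exact (hGc.tendsto (h y)).comp Filter.tendsto_comap
  refine htend.congr' ?_
  filter_upwards [htend (isOpen_Ioo.mem_nhds hy)] with a ha
  change G (stoneCechUnit a) ∈ Set.Ioo (-M) M at ha
  rw [hGa, Set.coe_projIcc] at ha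
  rw [hGa, Set.coe_projIcc]
  have h1 : min M (f a) < M := by
    rcases max_lt_iff.1 ha.2 with ⟨-, h⟩
    exact h
  have h2 : -M < min M (f a) := by
    rcases lt_max_iff.1 ha.1 with h | h
    · exact absurd h (lt_irrefl _)
    · exact h
  rw [max_eq_right h2.le]
  rcases min_lt_iff.1 h1 with h | h
  · exact absurd h (lt_irrefl _)
  · exact min_eq_right h.le

/-- A realcompact space in which `X` is densely `C`-embedded is the realcompactification. -/
theorem IsDenseCEmbedding.exists_iso {X N : TopCat.{u}} [T35Space X] {i : X ⟶ N}
    (hi : IsDenseCEmbedding i) (hN : IsRealcompact N) :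
    ∃ e : realcompactification X ≅ N, toRealcompactification X ≫ e.hom = i := by
  have hυ := isDenseCEmbedding_toRealcompactification X
  obtain ⟨e, he, -⟩ := hυ.existsUnique_lift hN i
  obtain ⟨h, hh, -⟩ := hi.existsUnique_lift
    (isRealcompact_of_compactSpace (TopCat.of (StoneCech X)))
    (TopCat.ofHom ⟨stoneCechUnit, continuous_stoneCechUnit⟩)
  have hh' : ∀ a, h (i a) = stoneCechUnit a := fun a => ConcreteCategory.congr_hom hh a
  let k : N ⟶ realcompactification X := TopCat.ofHom
    ⟨fun y => ⟨h y, hi.isRealPoint h.hom.continuous hh' y⟩,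
      h.hom.continuous.subtype_mk _⟩
  have hk : i ≫ k = toRealcompactification X := by
    ext a
    exact Subtype.ext (hh' a)
  have hT : T2Space (realcompactification X) :=
    inferInstanceAs (T2Space {x : StoneCech X // IsRealPoint X x})
  refine ⟨⟨e, k, ?_, ?_⟩, he⟩
  -- Density of `X` and the Hausdorff property suffice here; realcompactness of `υX` is not needed.
  · ext s
    refine congrFun (hυ.denseRange.equalizer (e ≫ k).hom.continuous continuous_id
      (funext fun a => ?_)) s
    exact ConcreteCategory.congr_hom
      (show toRealcompactification X ≫ e ≫ k = toRealcompactification X by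
        rw [← Category.assoc, he, hk]) a
  · exact (hi.existsUnique_lift hN i).unique
      (show i ≫ k ≫ e = i by rw [← Category.assoc, hk, he]) (Category.comp_id i)

/-! ### Rings of continuous functions -/

/-- Every ring homomorphism `C(Y, ℝ) → ℝ` on a realcompact space is evaluation at a point. -/
theorem IsRealcompact.exists_eval {Y : TopCat.{u}} (hY : IsRealcompact Y)
    (χ : C(Y, ℝ) →+* ℝ) : ∃ y : Y, ∀ f, χ f = f y := by
  obtain ⟨ι, e, he⟩ := hY
  -- The only ring endomorphism of `ℝ` is the identity, so `χ` is automatically `ℝ`-linear.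
  have hconst : ∀ c : ℝ, χ (ContinuousMap.const Y c) = c := fun c =>
    congrArg (fun φ : ℝ →+* ℝ => φ c)
      (Subsingleton.elim (χ.comp (algebraMap ℝ C(Y, ℝ))) (RingHom.id ℝ))
  have hzero : ∀ u : C(Y, ℝ), χ u = 0 → ∃ y, u y = 0 := by
    intro u hu
    by_contra! hne
    have := ((ContinuousMap.isUnit_iff_forall_ne_zero u).2 hne).map χ
    exact this.ne_zero hu
  let π : ι → C(Y, ℝ) := fun k => ⟨fun y => e y k, (continuous_apply k).comp he.continuous⟩
  -- The second condition determines `y` by injectivity of `e`, so the same point serves every `f`.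
  have key : ∀ f : C(Y, ℝ), ∃ y, f y = χ f ∧ e y = fun k => χ (π k) := by
    intro f
    have hcl : IsClosed (e '' {y | f y = χ f}) :=
      he.isClosedMap _ (isClosed_eq f.continuous continuous_const)
    have hmem : (fun k => χ (π k)) ∈ e '' {y | f y = χ f} := by
      rw [← hcl.closure_eq, mem_closure_iff]
      intro o ho hpo
      obtain ⟨I, u, hu, huo⟩ := isOpen_pi_iff.1 ho _ hpo
      -- A sum of squares of elements of the kernel of `χ` is not a unit, so it has a zero, where
      -- all its terms vanish.
      obtain ⟨y, hy⟩ := hzero ((f - ContinuousMap.const Y (χ f)) ^ 2 +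
        ∑ k ∈ I, (π k - ContinuousMap.const Y (χ (π k))) ^ 2) (by
          simp [map_sum, hconst])
      have hy' : (f y - χ f) ^ 2 + ∑ k ∈ I, (e y k - χ (π k)) ^ 2 = 0 := by
        simpa [π] using hy
      have hs : 0 ≤ ∑ k ∈ I, (e y k - χ (π k)) ^ 2 := Finset.sum_nonneg fun k _ => sq_nonneg _
      have hf0 : (f y - χ f) ^ 2 = 0 := by nlinarith [sq_nonneg (f y - χ f)]
      have hs0 : ∑ k ∈ I, (e y k - χ (π k)) ^ 2 = 0 := by linarith
      rw [Finset.sum_eq_zero_iff_of_nonneg fun k _ => sq_nonneg _] at hs0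
      refine ⟨e y, huo fun k hk => ?_, y, sub_eq_zero.1 (pow_eq_zero_iff two_ne_zero |>.1 hf0), rfl⟩
      rw [sub_eq_zero.1 (pow_eq_zero_iff two_ne_zero |>.1 (hs0 k hk))]
      exact (hu k hk).2
    obtain ⟨y, hy, hye⟩ := hmem
    exact ⟨y, hy, hye⟩
  obtain ⟨y, -, hy⟩ := key 0
  refine ⟨y, fun f => ?_⟩
  obtain ⟨z, hz, hze⟩ := key f
  rw [← hz, he.injective (hze.trans hy.symm)]

/-- A ring isomorphism onto the function ring of a realcompact space is induced by a dense
`C`-embedding. -/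
theorem IsRealcompact.exists_isDenseCEmbedding {X Y : TopCat.{u}} (hY : IsRealcompact Y)
    (φ : C(X, ℝ) ≃+* C(Y, ℝ)) : ∃ τ : X ⟶ Y, IsDenseCEmbedding τ := by
  have := hY.t35Space
  have hev : ∀ x : X, ∃ y : Y, ∀ f, φ.symm f x = f y := fun x =>
    hY.exists_eval ((ContinuousMap.evalAlgHom ℝ ℝ x).toRingHom.comp φ.symm.toRingHom)
  choose τ hτ using hev
  have hc : Continuous τ := by
    obtain ⟨ι, e, he⟩ := hY
    rw [he.isEmbedding.continuous_iff]
    refine continuous_pi fun k => ?_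
    refine (φ.symm ⟨fun y => e y k, (continuous_apply k).comp he.continuous⟩).continuous.congr ?_
    intro x
    exact hτ x _
  refine ⟨TopCat.ofHom ⟨τ, hc⟩, ?_, fun f => ⟨φ f, fun a => ?_⟩⟩
  · intro p
    by_contra hp
    obtain ⟨f, hf, hfp, hfc⟩ := CompletelyRegularSpace.completely_regular p _ isClosed_closure hp
    let F : C(Y, ℝ) := ⟨fun y => f y, by fun_prop⟩
    have hF : φ.symm F = φ.symm 1 := by
      ext x
      have h1 : f (τ x) = 1 := hfc (subset_closure ⟨x, rfl⟩)
      rw [hτ, hτ]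
      change (f (τ x) : ℝ) = 1
      simp [h1]
    have h := DFunLike.congr_fun (φ.symm.injective hF) p
    change (f p : ℝ) = 1 at h
    simp [hfp] at h
  · exact (hτ a (φ f)).symm.trans (by rw [φ.symm_apply_apply])

theorem IsDenseCEmbedding.nonempty_ringEquiv {X N : TopCat.{u}} {i : X ⟶ N}
    (hi : IsDenseCEmbedding i) : Nonempty (C(X, ℝ) ≃+* C(N, ℝ)) := by
  refine ⟨(RingEquiv.ofBijective (ContinuousMap.compRightAlgHom ℝ ℝ i.hom) ⟨?_, ?_⟩).symm⟩
  · intro f g hfg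
    refine DFunLike.coe_injective (hi.denseRange.equalizer f.continuous g.continuous ?_)
    exact congrArg DFunLike.coe hfg
  · intro f
    obtain ⟨F, hF⟩ := hi.exists_extension f
    exact ⟨F, ContinuousMap.ext hF⟩

theorem mainTheorem1 (P : ObjectProperty TopCat.{u}) [P.IsClosedUnderIsomorphisms]
    (hCpt : IsCompactHausdorff.{u} ≤ P)
    (hReal : P (TopCat.of (ULift.{u} ℝ)))
    (hRCpt : P ≤ IsRealcompact.{u})
    (X : TopCat.{u}) [T35Space X] :
    List.TFAE
      [AdmitsPification P X,
        P (realcompactification X),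
        ∃ Y : TopCat.{u}, P Y ∧ Nonempty (C(X, ℝ) ≃+* C(Y, ℝ))] ∧
    (P (realcompactification X) → IsPification P (toRealcompactification X)) ∧
    (∀ (N : TopCat.{u}) (i : X ⟶ N), IsPification P i →
      ∃ e : realcompactification X ≅ N, toRealcompactification X ≫ e.hom = i) ∧
    (∀ Y : TopCat.{u}, P Y → Nonempty (C(X, ℝ) ≃+* C(Y, ℝ)) →
      ∃ e : realcompactification X ≅ Y, IsPification P (toRealcompactification X ≫ e.hom)) := by
  have hυ := isDenseCEmbedding_toRealcompactification X
  have h3 : ∀ (N : TopCat.{u}) (i : X ⟶ N), IsPification P i →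
      ∃ e : realcompactification X ≅ N, toRealcompactification X ≫ e.hom = i :=
    fun N i hi => (hi.isDenseCEmbedding hReal hRCpt).exists_iso (hRCpt N hi.1)
  have h4 : ∀ Y : TopCat.{u}, P Y → Nonempty (C(X, ℝ) ≃+* C(Y, ℝ)) →
      ∃ e : realcompactification X ≅ Y,
        IsPification P (toRealcompactification X ≫ e.hom) := by
    rintro Y hY ⟨φ⟩
    obtain ⟨τ, hτ⟩ := (hRCpt Y hY).exists_isDenseCEmbedding φ
    obtain ⟨e, rfl⟩ := hτ.exists_iso (hRCpt Y hY)
    exact ⟨e, hτ.isPification hRCpt hY⟩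
  refine ⟨?_, hυ.isPification hRCpt, h3, h4⟩
  tfae_have 1 → 2 := by
    rintro ⟨N, i, hi⟩
    obtain ⟨e, -⟩ := h3 N i hi
    exact P.prop_of_iso e.symm hi.1
  tfae_have 2 → 3 := fun h => ⟨_, h, hυ.nonempty_ringEquiv⟩
  tfae_have 3 → 1 := by
    rintro ⟨Y, hY, hφ⟩
    obtain ⟨e, he⟩ := h4 Y hY hφ
    exact ⟨Y, _, he⟩
  tfae_finish
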